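/- Let $V\subset\mathbb{R}^2$ be a closed convex cone which is pointed, i.e. $V\cap(-V)=\{0\}$, and unbounded. Let $\mathcal{C}_V(\mathbb{R}^2)$ be the family of all nonempty closed convex sets $A\subset\mathbb{R}^2$ whose recession cone $\{x\in\mathbb{R}^2 : x+A\subset A\}$ equals $V$. For $A,B\in\mathcal{C}_V(\mathbb{R}^2)$ let $$[A,B]=\{(C,D)\in\mathcal{C}_V(\mathbb{R}^2)^2 : A+D=B+C\},$$ where $+$ is the Minkowski sum. The pair $(A,B)$ is called $0$-minimal if it is a minimal element, with respect to componentwise inclusion, of the set $\{(C,D)\in[A,B] : 0\in D\}$, and it is called reduced if $$[A,B]=\{(A+M,B+M) : M\in\mathcal{C}_V(\mathbb{R}^2)\}.$$ Then every $0$-minimal pair $(A,B)\in\mathcal{C}_V(\mathbb{R}^2)^2$ is reduced. -/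

import Mathlib

open scoped Pointwise

/-- The recession cone `{x | x + A ⊆ A}` of a set `A`. -/
def recessionCone {E : Type*} [AddCommGroup E] (A : Set E) : Set E :=
  {x | ∀ a ∈ A, x + a ∈ A}

/-- The family `𝒞_V(E)` of all nonempty closed convex sets whose recession cone is `V`. -/
def closedConvexWithRecession {E : Type*} [AddCommGroup E] [Module ℝ E] [TopologicalSpace E]
    (V : Set E) : Set (Set E) :=
  {A | A.Nonempty ∧ IsClosed A ∧ Convex ℝ A ∧ recessionCone A = V}

/-- The class `[A, B]`: all pairs `(C, D)` of members of `𝒞_V(E)` with `A + D = B + C`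
(Minkowski sums). -/
def pairClass {E : Type*} [AddCommGroup E] [Module ℝ E] [TopologicalSpace E]
    (V A B : Set E) : Set (Set E × Set E) :=
  {P | P.1 ∈ closedConvexWithRecession V ∧ P.2 ∈ closedConvexWithRecession V ∧
    A + P.2 = B + P.1}

/-- `(A, B)` is `0`-minimal: it is a minimal element, for componentwise inclusion, of the set of
all pairs `(C, D)` in the class `[A, B]` with `0 ∈ D`. -/
def IsZeroMinimalPair {E : Type*} [AddCommGroup E] [Module ℝ E] [TopologicalSpace E]
    (V A B : Set E) : Prop :=
  Minimal (fun P : Set E × Set E => P ∈ pairClass V A B ∧ (0 : E) ∈ P.2) (A, B)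

/-- `(A, B)` is reduced: the class `[A, B]` consists exactly of the pairs `(A + M, B + M)` with
`M` in `𝒞_V(E)`. -/
def IsReducedPair {E : Type*} [AddCommGroup E] [Module ℝ E] [TopologicalSpace E]
    (V A B : Set E) : Prop :=
  pairClass V A B = {P | ∃ M ∈ closedConvexWithRecession V, P = (A + M, B + M)}

/-! Choose coordinates in which `q` is positive on `V \ {0}`. The functionals `t p + q` that are
positive on `V \ {0}` form an open interval `I` of parameters. A member of `𝒞_V` is determined by
its lower support function on `I`, which is concave. Conversely every concave function on `I` arises
this way (`supportFn_wulffShape`), and Minkowski sums become sums of functions.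

Concave functions on an interval have the Riesz decomposition property: heuristically, take the
minimum of the measures `-a''` and `-b''`. Hence `A + D = B + C` gives `A = P + Q`, `D = R + S`, `B
= P + R`, `C = Q + S` within `𝒞_V`.

Since `0 ∈ B = P + R`, write `0 = x + y` with `x ∈ P`, `y ∈ R`. Then `(x + Q, x + R)` lies in `[A,
B]`, below `(A, B)`, with `0` in its second entry. By minimality `A = x + Q` and `B = x + R`, so `M
= S - x` gives `C = A + M` and `D = B + M`. -/

open Filter Topology

/-! ### Riesz decomposition of concave functions on finitely many nodes. -/

/-- `f` satisfies the concavity inequality for all triples of points of `S`, where `S` need not be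
convex. -/
def IsConcaveOnTriples (S : Set ℝ) (f : ℝ → ℝ) : Prop :=
  ∀ x ∈ S, ∀ y ∈ S, ∀ z ∈ S, x < y → y < z → (z - y) * f x + (y - x) * f z ≤ (z - x) * f y

theorem concaveOn_iff_isConcaveOnTriples {I : Set ℝ} (hI : Convex ℝ I) {f : ℝ → ℝ} :
    ConcaveOn ℝ I f ↔ IsConcaveOnTriples I f := by
  constructor
  · intro h x hx y hy z hz hxy hyz
    have := h.slope_anti_adjacent hx hz hxy hyz
    rw [div_le_div_iff₀ (by linarith) (by linarith)] at this
    linarith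
  · intro h
    refine concaveOn_of_slope_anti_adjacent hI fun {x y z} hx hz hxy hyz => ?_
    have hy : y ∈ I := hI.ordConnected.out hx hz ⟨hxy.le, hyz.le⟩
    have := h x hx y hy z hz hxy hyz
    rw [div_le_div_iff₀ (by linarith) (by linarith)]
    linarith

/-- An affine function minus a sum of nonnegative multiples of hinge functions is concave. -/
theorem isConcaveOnTriples_neg_sum_hinge (S : Set ℝ) {n : ℕ} {w : ℕ → ℝ} (t : ℕ → ℝ)
    (hw : ∀ k < n, 0 ≤ w k) (c s : ℝ) :
    IsConcaveOnTriples S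
      (fun x => c + s * x - ∑ k ∈ Finset.range n, w k * max (x - t k) 0) := by
  intro x _ y _ z _ hxy hyz
  have key : (z - x) * ∑ k ∈ Finset.range n, w k * max (y - t k) 0 ≤
      (z - y) * (∑ k ∈ Finset.range n, w k * max (x - t k) 0) +
      (y - x) * ∑ k ∈ Finset.range n, w k * max (z - t k) 0 := by
    simp only [Finset.mul_sum, ← Finset.sum_add_distrib]
    refine Finset.sum_le_sum fun k hk => ?_
    have h0 := hw k (Finset.mem_range.1 hk)
    have : (z - x) * max (y - t k) 0 ≤
        (z - y) * max (x - t k) 0 + (y - x) * max (z - t k) 0 := by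
      have h1 := le_max_left (x - t k) 0
      have h2 := le_max_right (x - t k) 0
      have h3 := le_max_left (z - t k) 0
      have h4 := le_max_right (z - t k) 0
      rcases max_cases (y - t k) 0 with ⟨h, _⟩ | ⟨h, _⟩ <;> rw [h] <;>
        nlinarith [mul_le_mul_of_nonneg_left h1 (sub_pos.2 hyz).le,
          mul_le_mul_of_nonneg_left h2 (sub_pos.2 hyz).le,
          mul_le_mul_of_nonneg_left h3 (sub_pos.2 hxy).le,
          mul_le_mul_of_nonneg_left h4 (sub_pos.2 hxy).le]
    nlinarith [mul_le_mul_of_nonneg_left this h0]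
  nlinarith [key]

/-- Summation by parts: on an increasing sequence of nodes a function is an affine function minus a
sum of hinge functions, weighted by the drops of its difference quotients. -/
theorem eq_affine_sub_sum_hinge {N : ℕ} {t : ℕ → ℝ} (ht : ∀ i j, i < j → j < N → t i < t j)
    (f : ℝ → ℝ) (σ : ℕ → ℝ) (hσ : ∀ k, σ k = (f (t (k + 1)) - f (t k)) / (t (k + 1) - t k))
    (j : ℕ) (hj : j < N) :
    f (t j) = f (t 0) + σ 0 * (t j - t 0) -
      ∑ k ∈ Finset.range (N - 2), (σ k - σ (k + 1)) * max (t j - t (k + 1)) 0 := by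
  induction j with
  | zero =>
    rw [Finset.sum_eq_zero]
    · ring
    · intro k hk
      have hk := Finset.mem_range.1 hk
      have := ht 0 (k + 1) (by omega) (by omega)
      rw [max_eq_right (by linarith), mul_zero]
  | succ j ih =>
    have hlt := ht j (j + 1) (by omega) hj
    have h1 : f (t (j + 1)) - f (t j) = σ j * (t (j + 1) - t j) := by
      rw [hσ, div_mul_cancel₀ _ (by linarith)]
    -- Only hinges with `k < j` are active on `[t j, t (j + 1)]`; their weights telescope to `σ 0 -
    -- σ j`.
    have h2 : ∑ k ∈ Finset.range (N - 2), (σ k - σ (k + 1)) * max (t (j + 1) - t (k + 1)) 0 -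
        ∑ k ∈ Finset.range (N - 2), (σ k - σ (k + 1)) * max (t j - t (k + 1)) 0 =
        (σ 0 - σ j) * (t (j + 1) - t j) := by
      rw [← Finset.sum_sub_distrib, ← Finset.sum_range_sub' σ j, Finset.sum_mul,
        ← Finset.sum_subset (Finset.range_subset_range.2 (show j ≤ N - 2 by omega))]
      · refine Finset.sum_congr rfl fun k hk => ?_
        have hk := Finset.mem_range.1 hk
        have h3 : t (k + 1) ≤ t j := by
          rcases Nat.lt_or_ge (k + 1) j with h | h
          · exact (ht _ _ h (by omega)).le
          · rw [show k + 1 = j by omega]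
        rw [max_eq_left (by linarith), max_eq_left (by linarith)]
        ring
      · intro k hk hk'
        rw [Finset.mem_range] at hk hk'
        have h3 : t (j + 1) ≤ t (k + 1) := by
          rcases Nat.lt_or_ge j k with h | h
          · exact (ht _ _ (by omega) (by omega)).le
          · rw [show k = j by omega]
        rw [max_eq_right (by linarith), max_eq_right (by linarith)]
        ring
    have ih := ih (by omega)
    linear_combination h1 + ih + h2

theorem Finset.exists_increasing_enumeration (S : Finset ℝ) :
    ∃ (N : ℕ) (t : ℕ → ℝ), (∀ i j, i < j → j < N → t i < t j) ∧ (∀ i < N, t i ∈ S) ∧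
      ∀ s ∈ S, ∃ i < N, t i = s := by
  refine ⟨S.card, fun i => if h : i < S.card then S.orderEmbOfFin rfl ⟨i, h⟩ else 0, ?_, ?_, ?_⟩
  · intro i j hij hj
    simp only [hj, hij.trans hj, dif_pos]
    exact (S.orderEmbOfFin rfl).strictMono hij
  · intro i hi
    simp only [hi, dif_pos]
    exact S.orderEmbOfFin_mem rfl _
  · intro s hs
    have : s ∈ Set.range (S.orderEmbOfFin rfl) := by rw [S.range_orderEmbOfFin]; exact hs
    obtain ⟨⟨i, hi⟩, rfl⟩ := this
    exact ⟨i, hi, by simp [hi]⟩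

theorem IsConcaveOnTriples.congr {S : Set ℝ} {f g : ℝ → ℝ} (hf : IsConcaveOnTriples S f)
    (h : ∀ x ∈ S, g x = f x) : IsConcaveOnTriples S g := by
  intro x hx y hy z hz hxy hyz
  rw [h x hx, h y hy, h z hz]
  exact hf x hx y hy z hz hxy hyz

theorem IsConcaveOnTriples.mono {S T : Set ℝ} {f : ℝ → ℝ} (hf : IsConcaveOnTriples T f)
    (h : S ⊆ T) : IsConcaveOnTriples S f :=
  fun x hx y hy z hz => hf x (h hx) y (h hy) z (h hz)

theorem IsConcaveOnTriples.add_affine {S : Set ℝ} {f : ℝ → ℝ} (hf : IsConcaveOnTriples S f)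
    (c s : ℝ) : IsConcaveOnTriples S (fun x => f x + (c + s * x)) := by
  intro x hx y hy z hz hxy hyz
  linarith [hf x hx y hy z hz hxy hyz]

/-- The Riesz decomposition property for concave functions modulo affine functions, on finitely
many nodes. -/
theorem exists_riesz_decomposition_finset (S : Finset ℝ) {a b c d : ℝ → ℝ}
    (ha : IsConcaveOnTriples S a) (hb : IsConcaveOnTriples S b) (hc : IsConcaveOnTriples S c)
    (hd : IsConcaveOnTriples S d) (h : ∀ x ∈ S, a x + d x = b x + c x) :
    ∃ m : ℝ → ℝ, IsConcaveOnTriples S m ∧ IsConcaveOnTriples S (fun x => a x - m x) ∧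
      IsConcaveOnTriples S (fun x => b x - m x) ∧
      IsConcaveOnTriples S (fun x => d x - b x + m x) := by
  obtain ⟨N, t, ht, htS, hSt⟩ := S.exists_increasing_enumeration
  let σ (f : ℝ → ℝ) (k : ℕ) : ℝ := (f (t (k + 1)) - f (t k)) / (t (k + 1) - t k)
  -- `w f k` is the bend of `f` at the interior node `t (k + 1)`, whence `N - 2` bends for `N`
  -- nodes.
  let w (f : ℝ → ℝ) (k : ℕ) : ℝ := σ f k - σ f (k + 1)
  have hw : ∀ f, IsConcaveOnTriples S f → ∀ k < N - 2, 0 ≤ w f k := by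
    intro f hf k hk
    have h1 := ht k (k + 1) (by omega) (by omega)
    have h2 := ht (k + 1) (k + 2) (by omega) (by omega)
    have := hf _ (htS k (by omega)) _ (htS (k + 1) (by omega)) _ (htS (k + 2) (by omega)) h1 h2
    refine sub_nonneg.2 ?_
    change (f (t (k + 2)) - f (t (k + 1))) / (t (k + 2) - t (k + 1)) ≤
      (f (t (k + 1)) - f (t k)) / (t (k + 1) - t k)
    rw [div_le_div_iff₀ (by linarith) (by linarith)]
    linarith
  have hrep : ∀ f, ∃ c s : ℝ, ∀ x ∈ S,
      f x = c + s * x - ∑ k ∈ Finset.range (N - 2), w f k * max (x - t (k + 1)) 0 := by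
    intro f
    refine ⟨f (t 0) - σ f 0 * t 0, σ f 0, fun x hx => ?_⟩
    obtain ⟨j, hj, rfl⟩ := hSt x hx
    rw [eq_affine_sub_sum_hinge ht f (σ f) (fun _ => rfl) j hj]
    ring
  have hadd : ∀ k < N - 2, w a k + w d k = w b k + w c k := by
    intro k hk
    have e : ∀ k < N - 1, σ a k + σ d k = σ b k + σ c k := by
      intro k hk
      have h0 := h _ (htS k (by omega))
      have h1 := h _ (htS (k + 1) (by omega))
      simp only [σ, ← add_div]
      congr 1
      linarith
    have := e k (by omega)
    have := e (k + 1) (by omega)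
    simp only [w]
    linarith
  -- The minimum is the largest bend common to `a` and `b`. As `w a + w d = w b + w c`, the
  -- remaining bend `w d - w b + u` is `min (w c) (w d)`, again nonnegative.
  let u (k : ℕ) : ℝ := min (w a k) (w b k)
  have hconc := fun (v : ℕ → ℝ) (hv : ∀ k < N - 2, 0 ≤ v k) (c s : ℝ) =>
    isConcaveOnTriples_neg_sum_hinge (S : Set ℝ) (fun k => t (k + 1)) hv c s
  obtain ⟨ca, sa, hra⟩ := hrep a
  obtain ⟨cb, sb, hrb⟩ := hrep b
  obtain ⟨cd, sd, hrd⟩ := hrep d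
  refine ⟨fun x => 0 + 0 * x - ∑ k ∈ Finset.range (N - 2), u k * max (x - t (k + 1)) 0,
    hconc u (fun k hk => le_min (hw a ha k hk) (hw b hb k hk)) 0 0,
    (hconc (fun k => w a k - u k) (fun k hk => sub_nonneg.2 (min_le_left _ _)) ca sa).congr ?_,
    (hconc (fun k => w b k - u k) (fun k hk => sub_nonneg.2 (min_le_right _ _)) cb sb).congr ?_,
    (hconc (fun k => w d k - w b k + u k) (fun k hk => ?_) (cd - cb) (sd - sb)).congr ?_⟩
  · intro x hx
    rw [hra x hx]
    simp only [sub_mul, Finset.sum_sub_distrib]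
    ring
  · intro x hx
    rw [hrb x hx]
    simp only [sub_mul, Finset.sum_sub_distrib]
    ring
  · have := hadd k hk
    have := hw d hd k hk
    have := hw c hc k hk
    rcases min_cases (w a k) (w b k) with ⟨h, _⟩ | ⟨h, _⟩ <;> simp only [u, h] <;> linarith
  · intro x hx
    rw [hrd x hx, hrb x hx]
    simp only [sub_mul, add_mul, Finset.sum_sub_distrib, Finset.sum_add_distrib]
    ring

/-! ### Passage from finite node sets to an interval. -/

/-- If `m` and `a - m` are concave and `m` vanishes at `p` and `q`, then `m` is bounded by the
difference between `a` and its chord over `[p, q]`. -/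
theorem abs_le_abs_sub_chord {S : Set ℝ} {p q x : ℝ} (hp : p ∈ S) (hq : q ∈ S) (hx : x ∈ S)
    (hpq : p < q) {a m : ℝ → ℝ} (hm : IsConcaveOnTriples S m)
    (ham : IsConcaveOnTriples S (fun x => a x - m x)) (hmp : m p = 0) (hmq : m q = 0) :
    (q - p) * |m x| ≤ |(q - p) * a x - (q - x) * a p - (x - p) * a q| := by
  have hD : 0 < q - p := by linarith
  rw [← abs_of_pos hD, ← abs_mul, abs_of_pos hD]
  -- On each side of `p` and `q` concavity fixes the sign of the deviation from the chord. It is the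
  -- same for `m` and `a - m`, so the two cannot cancel.
  rcases lt_trichotomy x p with h | rfl | h
  · have h1 := hm x hx p hp q hq h hpq
    have h2 := ham x hx p hp q hq h hpq
    simp only [hmp, hmq] at h1 h2
    rw [abs_of_nonpos (by linarith), abs_of_nonpos (by linarith)]
    linarith
  · simp [hmp]
  rcases lt_trichotomy x q with h' | rfl | h'
  · have h1 := hm p hp x hx q hq h h'
    have h2 := ham p hp x hx q hq h h'
    simp only [hmp, hmq] at h1 h2
    rw [abs_of_nonneg (by linarith), abs_of_nonneg (by linarith)]
    linarith
  · simp [hmq]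
  · have h1 := hm p hp q hq x hx hpq h'
    have h2 := ham p hp q hq x hx hpq h'
    simp only [hmp, hmq] at h1 h2
    rw [abs_of_nonpos (by linarith), abs_of_nonpos (by linarith)]
    linarith

theorem IsConcaveOnTriples.of_tendsto {ι : Type*} {l : Filter ι} [l.NeBot] {I : Set ℝ}
    {S : ι → Set ℝ} (hS : ∀ x ∈ I, ∀ᶠ i in l, x ∈ S i) {f : ι → ℝ → ℝ} {g : ℝ → ℝ}
    (hf : ∀ᶠ i in l, IsConcaveOnTriples (S i) (f i))
    (hfg : ∀ x ∈ I, Tendsto (fun i => f i x) l (𝓝 (g x))) : IsConcaveOnTriples I g := by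
  intro x hx y hy z hz hxy hyz
  refine le_of_tendsto_of_tendsto
    (((hfg x hx).const_mul (z - y)).add ((hfg z hz).const_mul (y - x)))
    ((hfg y hy).const_mul (z - x)) ?_
  filter_upwards [hf, hS x hx, hS y hy, hS z hz] with i hi hx hy hz
  exact hi x hx y hy z hz hxy hyz

/-- The Riesz decomposition property for concave functions modulo affine functions. -/
theorem ConcaveOn.exists_riesz_decomposition {I : Set ℝ} {a b c d : ℝ → ℝ}
    (ha : ConcaveOn ℝ I a) (hb : ConcaveOn ℝ I b) (hc : ConcaveOn ℝ I c) (hd : ConcaveOn ℝ I d)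
    (h : ∀ x ∈ I, a x + d x = b x + c x) :
    ∃ m : ℝ → ℝ, ConcaveOn ℝ I m ∧ ConcaveOn ℝ I (fun x => a x - m x) ∧
      ConcaveOn ℝ I (fun x => b x - m x) ∧ ConcaveOn ℝ I (fun x => d x - b x + m x) := by
  have hI := ha.1
  simp only [concaveOn_iff_isConcaveOnTriples hI] at *
  by_cases hsub : I.Subsingleton
  · have triv : ∀ f, IsConcaveOnTriples I f := fun f x hx y hy z hz hxy _ =>
      absurd (hsub hx hy) hxy.ne
    exact ⟨0, triv _, triv _, triv _, triv _⟩
  obtain ⟨p, hp, q, hq, hpq⟩ : ∃ p ∈ I, ∃ q ∈ I, p < q := by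
    rw [Set.not_subsingleton_iff] at hsub
    obtain ⟨p, hp, q, hq, hne⟩ := hsub
    rcases hne.lt_or_gt with h | h
    exacts [⟨p, hp, q, hq, h⟩, ⟨q, hq, p, hp, h⟩]
  have hD : 0 < q - p := by linarith
  have hfin : ∀ S : Finset ℝ, ∃ m : ℝ → ℝ, m p = 0 ∧ m q = 0 ∧ ((S : Set ℝ) ⊆ I →
      IsConcaveOnTriples S m ∧ IsConcaveOnTriples S (fun x => a x - m x) ∧
      IsConcaveOnTriples S (fun x => b x - m x) ∧
      IsConcaveOnTriples S (fun x => d x - b x + m x)) := by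
    intro S
    by_cases hS : (S : Set ℝ) ⊆ I
    · obtain ⟨m, h1, h2, h3, h4⟩ := exists_riesz_decomposition_finset S (ha.mono hS) (hb.mono hS)
        (hc.mono hS) (hd.mono hS) fun x hx => h x (hS hx)
      -- Subtracting the chord of `m` over `[p, q]` preserves all four concavity conditions and
      -- normalises `m` to vanish at `p` and `q`.
      let s := (m q - m p) / (q - p)
      have hs : s * (q - p) = m q - m p := div_mul_cancel₀ _ hD.ne'
      refine ⟨fun x => m x + ((s * p - m p) + (-s) * x), by ring, by linarith, fun _ =>
        ⟨h1.add_affine _ _, (h2.add_affine (m p - s * p) s).congr fun x _ => by ring,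
          (h3.add_affine (m p - s * p) s).congr fun x _ => by ring,
          (h4.add_affine (s * p - m p) (-s)).congr fun x _ => by ring⟩⟩
    · exact ⟨0, rfl, rfl, fun h => absurd h hS⟩
  choose m hmp hmq hm using hfin
  classical
  let e : Finset I → Finset ℝ := fun S => S.map (Function.Embedding.subtype _)
  have heI : ∀ S, ((e S : Finset ℝ) : Set ℝ) ⊆ I := by
    intro S x hx
    simp only [e, Finset.coe_map, Set.mem_image] at hx
    obtain ⟨y, -, rfl⟩ := hx
    exact y.2
  -- An ultrafilter finer than `atTop` on finite subsets of `I` makes the bounded values converge at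
  -- all points of `I` simultaneously.
  let U : Ultrafilter (Finset I) := Ultrafilter.of atTop
  have hU : ∀ x ∈ I, ∀ᶠ S in (U : Filter (Finset I)), x ∈ ((e S : Finset ℝ) : Set ℝ) := by
    intro x hx
    refine Ultrafilter.of_le atTop ?_
    filter_upwards [eventually_ge_atTop {(⟨x, hx⟩ : I)}] with S hS
    simp only [e, Finset.coe_map, Set.mem_image]
    exact ⟨⟨x, hx⟩, hS (Finset.mem_singleton_self _), rfl⟩
  have hlim : ∀ x, ∃ y, x ∈ I → Tendsto (fun S => m (e S) x) U (𝓝 y) := by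
    intro x
    by_cases hx : x ∈ I
    · let C := |(q - p) * a x - (q - x) * a p - (x - p) * a q| / (q - p)
      have hmem : ∀ᶠ S in (U : Filter (Finset I)), m (e S) x ∈ Set.Icc (-C) C := by
        filter_upwards [hU x hx, hU p hp, hU q hq] with S h1 h2 h3
        obtain ⟨h4, h5, -, -⟩ := hm (e S) (heI S)
        rw [Set.mem_Icc, ← abs_le, le_div_iff₀ hD, mul_comm]
        exact abs_le_abs_sub_chord h2 h3 h1 hpq h4 h5 (hmp _) (hmq _)
      obtain ⟨y, -, hy⟩ := isCompact_Icc.ultrafilter_le_nhds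
        (U.map fun S => m (e S) x) (le_principal_iff.2 hmem)
      exact ⟨y, fun _ => hy⟩
    · exact ⟨0, fun h => absurd h hx⟩
  choose g hg using hlim
  refine ⟨g, .of_tendsto hU (.of_forall fun S => (hm _ (heI S)).1) hg,
    .of_tendsto hU (.of_forall fun S => (hm _ (heI S)).2.1) fun x hx => (hg x hx).const_sub _,
    .of_tendsto hU (.of_forall fun S => (hm _ (heI S)).2.2.1) fun x hx => (hg x hx).const_sub _,
    .of_tendsto hU (.of_forall fun S => (hm _ (heI S)).2.2.2) fun x hx => (hg x hx).const_add _⟩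

/-- At an interior point the one-sided derivatives are finite and ordered, so either is the slope of
a supporting line. At an endpoint this could fail, as for a square root. -/
theorem ConcaveOn.exists_affine_majorant {I : Set ℝ} (hI : IsOpen I) {f : ℝ → ℝ}
    (hf : ConcaveOn ℝ I f) {t₀ : ℝ} (ht₀ : t₀ ∈ I) :
    ∃ s : ℝ, ∀ t ∈ I, f t ≤ f t₀ + s * (t - t₀) := by
  have hg : ConvexOn ℝ I (-f) := hf.neg
  have hint : t₀ ∈ interior I := by rwa [hI.interior_eq]
  refine ⟨-derivWithin (-f) (Set.Ioi t₀) t₀, fun t ht => ?_⟩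
  rcases lt_trichotomy t t₀ with h | rfl | h
  · have h1 := (hg.slope_le_leftDeriv_of_mem_interior ht hint h).trans
      (hg.leftDeriv_le_rightDeriv_of_mem_interior hint)
    rw [slope_def_field, div_le_iff₀ (by linarith)] at h1
    simp only [Pi.neg_apply] at h1
    linarith
  · simp
  · have h1 := hg.rightDeriv_le_slope_of_mem_interior hint ht h
    rw [slope_def_field, le_div_iff₀ (by linarith)] at h1
    simp only [Pi.neg_apply] at h1
    linarith

/-! ### Recession cones, compact slices and closed sums. -/

section Recession

variable {E : Type*} [NormedAddCommGroup E] [NormedSpace ℝ E]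

theorem nsmul_add_mem_of_mem_recessionCone {M : Set E} {x m : E} (hx : x ∈ recessionCone M)
    (hm : m ∈ M) (n : ℕ) : (n : ℝ) • x + m ∈ M := by
  induction n with
  | zero => simpa using hm
  | succ n ih =>
    have := hx _ ih
    rwa [show ((n + 1 : ℕ) : ℝ) • x + m = x + ((n : ℝ) • x + m) by push_cast; module]

/-- A functional that is bounded below on a nonempty set is nonnegative on its recession cone. -/
theorem nonneg_of_mem_recessionCone {M : Set E} (hM : M.Nonempty) {x : E}
    (hx : x ∈ recessionCone M) {f : StrongDual ℝ E} (hf : BddBelow (f '' M)) : 0 ≤ f x := by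
  obtain ⟨m, hm⟩ := hM
  obtain ⟨u, hu⟩ := hf
  by_contra! hneg
  obtain ⟨n, hn⟩ := exists_nat_gt ((f m - u) / -f x)
  rw [div_lt_iff₀ (by linarith)] at hn
  have := hu ⟨_, nsmul_add_mem_of_mem_recessionCone hx hm n, rfl⟩
  simp only [map_add, map_smul, smul_eq_mul] at this
  linarith

theorem recessionCone_pointedCone (V : PointedCone ℝ E) : recessionCone (V : Set E) = V := by
  ext x
  refine ⟨fun h => ?_, fun hx a ha => V.add_mem hx ha⟩
  simpa using h 0 V.zero_mem

theorem pointedCone_mem_closedConvexWithRecession {V : PointedCone ℝ E}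
    (hV : IsClosed (V : Set E)) : (V : Set E) ∈ closedConvexWithRecession (V : Set E) :=
  ⟨⟨0, V.zero_mem⟩, hV, V.convex, recessionCone_pointedCone V⟩

variable [FiniteDimensional ℝ E]

/-- A pointed closed cone admits a functional that is positive on its nonzero vectors. -/
theorem exists_strongDual_pos {V : PointedCone ℝ E} (hV : IsClosed (V : Set E))
    (hpt : (V : Set E) ∩ -(V : Set E) = {0}) :
    ∃ f : StrongDual ℝ E, ∀ v ∈ V, v ≠ 0 → 0 < f v := by
  let C : ProperCone ℝ E := ⟨V, hV⟩
  have hK : IsCompact ((V : Set E) ∩ Metric.sphere 0 1) :=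
    (isCompact_sphere (0 : E) 1).inter_left hV
  obtain ⟨f, hf0, hf⟩ : ∃ f : StrongDual ℝ E, (∀ v ∈ V, 0 ≤ f v) ∧
      ∀ v ∈ (V : Set E) ∩ Metric.sphere 0 1, v ∈ V → 0 < f v := by
    refine hK.induction_on (p := fun s => ∃ f : StrongDual ℝ E, (∀ v ∈ V, 0 ≤ f v) ∧
      ∀ v ∈ s, v ∈ V → 0 < f v) ⟨0, by simp, by simp⟩ ?_ ?_ ?_
    · rintro s t hst ⟨f, hf0, hf⟩
      exact ⟨f, hf0, fun v hv => hf v (hst hv)⟩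
    · rintro s t ⟨f, hf0, hf⟩ ⟨g, hg0, hg⟩
      refine ⟨f + g, fun v hv => add_nonneg (hf0 v hv) (hg0 v hv), ?_⟩
      rintro v (hv | hv) hvV
      · exact add_pos_of_pos_of_nonneg (hf v hv hvV) (hg0 v hvV)
      · exact add_pos_of_nonneg_of_pos (hf0 v hvV) (hg v hv hvV)
    · rintro x ⟨hxV, hx1⟩
      have hxn : -x ∉ C := by
        intro h
        have : x ∈ ({0} : Set E) := hpt ▸ ⟨hxV, h⟩
        rw [Set.mem_singleton_iff.1 this] at hx1
        simp at hx1
      -- Separating `-x` from `V` gives a functional nonnegative on `V` and positive near `x`; by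
      -- compactness finitely many of these sum to the desired one.
      obtain ⟨f, hf0, hf⟩ := C.hyperplane_separation_point hxn
      refine ⟨{y | 0 < f y}, mem_nhdsWithin_of_mem_nhds
        ((isOpen_lt continuous_const f.continuous).mem_nhds ?_), f, fun v hv => hf0 v hv,
        fun v hv _ => hv⟩
      simpa using hf
  refine ⟨f, fun v hv hv0 => ?_⟩
  have hn : 0 < ‖v‖ := norm_pos_iff.2 hv0
  have := hf (‖v‖⁻¹ • v) ⟨V.smul_mem (by positivity) hv, by
    simp [norm_smul, hn.ne']⟩ (V.smul_mem (by positivity) hv)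
  rw [map_smul, smul_eq_mul] at this
  exact (mul_pos_iff_of_pos_left (by positivity)).1 this

variable {V A B : Set E}

/-- The slices of a set of `𝒞_V(E)` by a functional that is positive on `V \ {0}` are compact. -/
theorem isCompact_slice (hA : A ∈ closedConvexWithRecession V) {f : StrongDual ℝ E}
    (hf : ∀ v ∈ V, v ≠ 0 → 0 < f v) (c : ℝ) : IsCompact (A ∩ {z | f z ≤ c}) := by
  obtain ⟨-, hcl, hconv, hrec⟩ := hA
  have hscl : IsClosed (A ∩ {z | f z ≤ c}) := hcl.inter (isClosed_le f.continuous continuous_const)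
  have hsconv : Convex ℝ (A ∩ {z | f z ≤ c}) :=
    hconv.inter (convex_halfSpace_le f.toLinearMap.isLinear c)
  refine Metric.isCompact_of_isClosed_isBounded hscl ?_
  rw [isBounded_iff_asymptoticCone_subset_singleton]
  -- A nonzero asymptotic direction of the slice would lie in `V`, where `f` is positive, yet moving
  -- along it must keep `f ≤ c`.
  intro v hv
  by_contra hv0
  have hvV : v ∈ V := by
    rw [← hrec]
    intro a ha
    simpa using hconv.smul_vadd_mem_of_isClosed_of_mem_asymptoticCone hcl zero_le_one
      (asymptoticCone_mono Set.inter_subset_left hv) ha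
  have hpos := hf v hvV hv0
  obtain ⟨a, ha⟩ := (asymptoticCone_nonempty (k := ℝ)).1 ⟨v, hv⟩
  obtain ⟨n, hn⟩ := exists_nat_gt ((c - f a) / f v)
  rw [div_lt_iff₀ hpos] at hn
  have := (hsconv.smul_vadd_mem_of_isClosed_of_mem_asymptoticCone hscl (Nat.cast_nonneg n) hv ha).2
  simp only [vadd_eq_add, Set.mem_ofPred_eq, map_add, map_smul, smul_eq_mul] at this
  linarith

theorem bddBelow_image_of_pos (hA : A ∈ closedConvexWithRecession V) {f : StrongDual ℝ E}
    (hf : ∀ v ∈ V, v ≠ 0 → 0 < f v) : BddBelow (f '' A) := by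
  obtain ⟨u, hu⟩ := ((isCompact_slice hA hf 0).image f.continuous).bddBelow
  refine ⟨min u 0, ?_⟩
  rintro _ ⟨a, ha, rfl⟩
  rcases le_total (f a) 0 with h | h
  · exact (min_le_left _ _).trans (hu ⟨a, ⟨ha, h⟩, rfl⟩)
  · exact (min_le_right _ _).trans h

/-- Since `f` is bounded below on `B`, only a compact slice of `A` contributes to the sum near a
given point, and compact plus closed is closed. -/
theorem isClosed_add_of_pos (hA : A ∈ closedConvexWithRecession V)
    (hB : B ∈ closedConvexWithRecession V) {f : StrongDual ℝ E}
    (hf : ∀ v ∈ V, v ≠ 0 → 0 < f v) : IsClosed (A + B) := by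
  obtain ⟨u, hu⟩ := bddBelow_image_of_pos hB hf
  refine isClosed_of_closure_subset fun z hz => ?_
  have hK := isCompact_slice hA hf (f z + 1 - u)
  have hcl : IsClosed (A ∩ {y | f y ≤ f z + 1 - u} + B) := hB.2.1.add_left_of_isCompact hK
  have hU : {y | f y < f z + 1} ∈ 𝓝 z :=
    (isOpen_lt f.continuous continuous_const).mem_nhds (by simp)
  refine Set.add_subset_add_right Set.inter_subset_left (hcl.closure_subset ?_)
  rw [mem_closure_iff_nhds] at hz ⊢
  intro t ht
  obtain ⟨y, ⟨hyt, hyU⟩, a, ha, b, hb, rfl⟩ := hz _ (Filter.inter_mem ht hU)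
  have := hu ⟨b, hb, rfl⟩
  simp only [Set.mem_ofPred_eq, map_add] at hyU
  exact ⟨_, hyt, a, ⟨ha, by simp only [Set.mem_ofPred_eq]; linarith⟩, b, hb, rfl⟩

end Recession

/-! ### The correspondence between planar sets and concave functions. -/

section Planar

variable {E : Type*} [NormedAddCommGroup E] [NormedSpace ℝ E]

/-- The functional `t p + q`. -/
noncomputable def pencil (p q : StrongDual ℝ E) (t : ℝ) : StrongDual ℝ E := t • p + q

theorem pencil_apply (p q : StrongDual ℝ E) (t : ℝ) (z : E) :
    pencil p q t z = t * p z + q z := by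
  simp [pencil]

/-- The parameters for which the functional `t p + q` is positive on `V \ {0}`. -/
def positiveParams (V : Set E) (p q : StrongDual ℝ E) : Set ℝ :=
  {t | ∀ v ∈ V, v ≠ 0 → 0 < pencil p q t v}

/-- The (lower) support function of `A` along the functionals `t p + q`. -/
noncomputable def supportFn (p q : StrongDual ℝ E) (A : Set E) (t : ℝ) : ℝ :=
  sInf (pencil p q t '' A)

/-- The intersection of the half-planes `f t ≤ t p + q` for `t` in `I`. -/
def wulffShape (p q : StrongDual ℝ E) (I : Set ℝ) (f : ℝ → ℝ) : Set E :=
  {z | ∀ t ∈ I, f t ≤ pencil p q t z}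

/-- The functionals `(q, p)` are the coordinates for the basis `(e, g)` of a plane, `e` lies in `V`,
and `q` is positive on `V \ {0}`. -/
structure IsAdaptedFrame (V : Set E) (e g : E) (p q : StrongDual ℝ E) : Prop where
  mem : e ∈ V
  pos : ∀ v ∈ V, v ≠ 0 → 0 < q v
  p_e : p e = 0
  q_e : q e = 1
  p_g : p g = 1
  q_g : q g = 0
  repr : ∀ z, z = q z • e + p z • g

variable {V : PointedCone ℝ E} {A B : Set E} {e g : E} {p q : StrongDual ℝ E}

theorem isOpen_positiveParams [FiniteDimensional ℝ E] (hV : IsClosed (V : Set E)) :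
    IsOpen (positiveParams (V : Set E) p q) := by
  have hK : IsCompact ((V : Set E) ∩ Metric.sphere 0 1) :=
    (isCompact_sphere (0 : E) 1).inter_left hV
  have heq : positiveParams (V : Set E) p q =
      {t | ∀ v ∈ (V : Set E) ∩ Metric.sphere 0 1, 0 < pencil p q t v} := by
    ext t
    constructor
    · rintro h v ⟨hv, hv1⟩
      exact h v hv fun h0 => by simp [h0] at hv1
    · intro h v hv hv0
      have hn : 0 < ‖v‖ := norm_pos_iff.2 hv0
      have := h (‖v‖⁻¹ • v) ⟨V.smul_mem (by positivity) hv, by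
        simp [norm_smul, hn.ne']⟩
      rw [map_smul, smul_eq_mul] at this
      exact (mul_pos_iff_of_pos_left (by positivity)).1 this
  rw [heq, isOpen_iff_mem_nhds]
  intro t ht
  refine hK.eventually_forall_of_forall_eventually fun v hv => ?_
  refine (isOpen_lt continuous_const ?_).mem_nhds (ht v hv)
  simp only [pencil_apply]
  fun_prop

theorem convex_positiveParams (V : Set E) (p q : StrongDual ℝ E) :
    Convex ℝ (positiveParams V p q) := by
  intro s hs t ht a b ha hb hab v hv hv0
  have h1 := hs v hv hv0
  have h2 := ht v hv hv0
  have h3 : pencil p q (a • s + b • t) v = a * pencil p q s v + b * pencil p q t v := by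
    simp only [pencil_apply, smul_eq_mul]
    linear_combination -(q v) * hab
  rw [h3]
  rcases ha.eq_or_lt with rfl | ha
  · rw [zero_add] at hab
    simpa [hab] using h2
  · positivity

theorem supportFn_le {t : ℝ} (hA : BddBelow (pencil p q t '' A)) {z : E} (hz : z ∈ A) :
    supportFn p q A t ≤ pencil p q t z :=
  csInf_le hA ⟨z, hz, rfl⟩

theorem le_supportFn (hA : A.Nonempty) {t c : ℝ} (h : ∀ z ∈ A, c ≤ pencil p q t z) :
    c ≤ supportFn p q A t :=
  le_csInf (hA.image _) (by rintro _ ⟨z, hz, rfl⟩; exact h z hz)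

theorem concaveOn_supportFn {I : Set ℝ} (hI : Convex ℝ I) (hne : A.Nonempty)
    (hA : ∀ t ∈ I, BddBelow (pencil p q t '' A)) : ConcaveOn ℝ I (supportFn p q A) := by
  refine ⟨hI, fun s hs t ht a b ha hb hab => le_supportFn hne fun z hz => ?_⟩
  have h1 := mul_le_mul_of_nonneg_left (supportFn_le (hA s hs) hz) ha
  have h2 := mul_le_mul_of_nonneg_left (supportFn_le (hA t ht) hz) hb
  simp only [pencil_apply, smul_eq_mul] at *
  have h3 : (a * s + b * t) * p z + q z = a * (s * p z + q z) + b * (t * p z + q z) := by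
    linear_combination -(q z) * hab
  linarith

theorem supportFn_add {t : ℝ} (hA : A.Nonempty) (hB : B.Nonempty)
    (hA' : BddBelow (pencil p q t '' A)) (hB' : BddBelow (pencil p q t '' B)) :
    supportFn p q (A + B) t = supportFn p q A t + supportFn p q B t := by
  rw [supportFn, Set.image_add, csInf_add (hA.image _) hA' (hB.image _) hB']
  rfl

/-- A point of the plane is an affine function of `t`; a supporting line of `f` at `t` is thus a
point of the shape where the constraint at `t` is tight. -/
theorem exists_mem_wulffShape (hF : IsAdaptedFrame (V : Set E) e g p q) {I : Set ℝ}
    (hI : IsOpen I) {f : ℝ → ℝ} (hf : ConcaveOn ℝ I f) {t : ℝ} (ht : t ∈ I) :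
    ∃ z ∈ wulffShape p q I f, pencil p q t z = f t := by
  obtain ⟨s, hs⟩ := hf.exists_affine_majorant hI ht
  have h : ∀ r, pencil p q r ((f t - s * t) • e + s • g) = f t + s * (r - t) := by
    intro r
    simp only [pencil_apply, map_add, map_smul, hF.p_e, hF.q_e, hF.p_g, hF.q_g, smul_eq_mul]
    ring
  exact ⟨_, fun r hr => (h r).symm ▸ hs r hr, by rw [h]; ring⟩

theorem zero_mem_positiveParams (hF : IsAdaptedFrame (V : Set E) e g p q) :
    (0 : ℝ) ∈ positiveParams (V : Set E) p q := by
  intro v hv hv0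
  simpa [pencil_apply] using hF.pos v hv hv0

theorem vadd_mem_closedConvexWithRecession (x : E)
    (hA : A ∈ closedConvexWithRecession (V : Set E)) :
    x +ᵥ A ∈ closedConvexWithRecession (V : Set E) := by
  refine ⟨hA.1.vadd_set, hA.2.1.vadd x, hA.2.2.1.vadd x, ?_⟩
  rw [← hA.2.2.2]
  ext y
  constructor
  · intro h a ha
    obtain ⟨b, hb, hb'⟩ := h (x + a) ⟨a, ha, rfl⟩
    rw [show y + a = b from add_left_cancel (a := x) (by
      have hb' : x + b = y + (x + a) := hb'
      rw [hb']; abel)]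
    exact hb
  · rintro h _ ⟨a, ha, rfl⟩
    exact ⟨y + a, h a ha, by simp only [vadd_eq_add]; abel⟩

variable [FiniteDimensional ℝ E]

theorem eq_wulffShape_supportFn (hF : IsAdaptedFrame (V : Set E) e g p q)
    (hA : A ∈ closedConvexWithRecession (V : Set E)) :
    A = wulffShape p q (positiveParams (V : Set E) p q) (supportFn p q A) := by
  refine Set.Subset.antisymm
    (fun z hz t ht => supportFn_le (bddBelow_image_of_pos hA ht) hz) fun z hz => ?_
  by_contra hzA
  obtain ⟨f, u, hfz, hfA⟩ := geometric_hahn_banach_point_closed hA.2.2.1 hA.2.1 hzA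
  have hf0 : ∀ v ∈ V, 0 ≤ f v := fun v hv =>
    nonneg_of_mem_recessionCone hA.1 (by rwa [hA.2.2.2])
      ⟨u, by rintro _ ⟨a, ha, rfl⟩; exact (hfA a ha).le⟩
  obtain ⟨k, hk⟩ := bddBelow_image_of_pos hA hF.pos
  -- The separating functional `f` may vanish on part of `V`. Adding `ε q` makes it positive on `V \
  -- {0}`, and this `ε` is small enough to keep the separation. Dividing by the value `f e + ε` at
  -- `e` puts it into the pencil.
  let ε := (u - f z) / (|q z - k| + 1)
  have hden : 0 < |q z - k| + 1 := by positivity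
  have hε : 0 < ε := div_pos (by linarith) hden
  have hε' : ε * (|q z - k| + 1) = u - f z := div_mul_cancel₀ _ hden.ne'
  have hlt : f z + ε * q z < u + ε * k := by
    nlinarith [mul_le_mul_of_nonneg_left (le_abs_self (q z - k)) hε.le]
  have hc : 0 < f e + ε := add_pos_of_nonneg_of_pos (hf0 e hF.mem) hε
  have hpen : ∀ y, (f e + ε) * pencil p q (f g / (f e + ε)) y = f y + ε * q y := by
    intro y
    have h1 : f y = q y * f e + p y * f g := by
      conv_lhs => rw [hF.repr y]
      simp
    rw [pencil_apply, h1]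
    field_simp
    ring
  have ht : f g / (f e + ε) ∈ positiveParams (V : Set E) p q := by
    intro v hv hv0
    have h1 := mul_pos hε (hF.pos v hv hv0)
    have h2 := hf0 v hv
    exact (mul_pos_iff_of_pos_left hc).1 (by rw [hpen]; linarith)
  have h1 : (u + ε * k) / (f e + ε) ≤ supportFn p q A (f g / (f e + ε)) := by
    refine le_supportFn hA.1 fun a ha => ?_
    rw [div_le_iff₀ hc, mul_comm (pencil _ _ _ _), hpen]
    have := mul_le_mul_of_nonneg_left (hk ⟨a, ha, rfl⟩) hε.le
    linarith [hfA a ha]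
  have h2 := h1.trans (hz _ ht)
  rw [div_le_iff₀ hc, mul_comm (pencil _ _ _ _), hpen] at h2
  linarith

theorem eq_of_supportFn_eq (hF : IsAdaptedFrame (V : Set E) e g p q)
    (hA : A ∈ closedConvexWithRecession (V : Set E))
    (hB : B ∈ closedConvexWithRecession (V : Set E))
    (h : ∀ t ∈ positiveParams (V : Set E) p q, supportFn p q A t = supportFn p q B t) :
    A = B := by
  rw [eq_wulffShape_supportFn hF hA, eq_wulffShape_supportFn hF hB]
  ext z
  exact forall₂_congr fun t ht => by rw [h t ht]

/-- `V` is the Wulff shape of its own support function, which is at most `0` because `0 ∈ V`. This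
bounds recession cones from above. -/
theorem mem_of_pencil_nonneg (hV : IsClosed (V : Set E))
    (hF : IsAdaptedFrame (V : Set E) e g p q) {x : E}
    (hx : ∀ t ∈ positiveParams (V : Set E) p q, 0 ≤ pencil p q t x) : x ∈ V := by
  have hVV := pointedCone_mem_closedConvexWithRecession hV
  rw [← SetLike.mem_coe, eq_wulffShape_supportFn hF hVV]
  intro t ht
  refine le_trans ?_ (hx t ht)
  simpa using supportFn_le (bddBelow_image_of_pos hVV ht) V.zero_mem

theorem add_mem_closedConvexWithRecession (hV : IsClosed (V : Set E))
    (hF : IsAdaptedFrame (V : Set E) e g p q) (hA : A ∈ closedConvexWithRecession (V : Set E))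
    (hB : B ∈ closedConvexWithRecession (V : Set E)) :
    A + B ∈ closedConvexWithRecession (V : Set E) := by
  refine ⟨hA.1.add hB.1, isClosed_add_of_pos hA hB hF.pos, hA.2.2.1.add hB.2.2.1, ?_⟩
  refine Set.Subset.antisymm (fun x hx => mem_of_pencil_nonneg hV hF fun t ht =>
    nonneg_of_mem_recessionCone (hA.1.add hB.1) hx ?_) ?_
  · rw [Set.image_add]
    exact (bddBelow_image_of_pos hA ht).add (bddBelow_image_of_pos hB ht)
  · rintro x hx _ ⟨a, ha, b, hb, rfl⟩
    rw [← hA.2.2.2] at hx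
    exact ⟨x + a, hx a ha, b, hb, add_assoc _ _ _⟩

theorem wulffShape_mem_closedConvexWithRecession (hV : IsClosed (V : Set E))
    (hF : IsAdaptedFrame (V : Set E) e g p q) {f : ℝ → ℝ}
    (hf : ConcaveOn ℝ (positiveParams (V : Set E) p q) f) :
    wulffShape p q (positiveParams (V : Set E) p q) f ∈
      closedConvexWithRecession (V : Set E) := by
  obtain ⟨z, hz, -⟩ := exists_mem_wulffShape hF (isOpen_positiveParams hV) hf
    (zero_mem_positiveParams hF)
  have heq : wulffShape p q (positiveParams (V : Set E) p q) f =
      ⋂ t ∈ positiveParams (V : Set E) p q, {z | f t ≤ pencil p q t z} := by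
    ext
    simp [wulffShape]
  refine ⟨⟨z, hz⟩, ?_, ?_, Set.Subset.antisymm (fun x hx => mem_of_pencil_nonneg hV hF fun t ht =>
    nonneg_of_mem_recessionCone ⟨z, hz⟩ hx
      ⟨f t, by rintro _ ⟨y, hy, rfl⟩; exact hy t ht⟩) ?_⟩
  · rw [heq]
    exact isClosed_biInter fun t _ => isClosed_le continuous_const (pencil p q t).continuous
  · rw [heq]
    exact convex_iInter₂ fun t _ => convex_halfSpace_ge (pencil p q t).toLinearMap.isLinear _
  · intro x hx y hy t ht
    have h1 := hy t ht
    have h2 : 0 ≤ pencil p q t x := by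
      rcases eq_or_ne x 0 with rfl | h0
      · simp
      · exact (ht x hx h0).le
    rw [map_add]
    linarith

theorem supportFn_wulffShape (hV : IsClosed (V : Set E))
    (hF : IsAdaptedFrame (V : Set E) e g p q) {f : ℝ → ℝ}
    (hf : ConcaveOn ℝ (positiveParams (V : Set E) p q) f) {t : ℝ}
    (ht : t ∈ positiveParams (V : Set E) p q) :
    supportFn p q (wulffShape p q (positiveParams (V : Set E) p q) f) t = f t := by
  obtain ⟨z, hz, hzt⟩ := exists_mem_wulffShape hF (isOpen_positiveParams hV) hf ht
  refine le_antisymm ?_ (le_supportFn ⟨z, hz⟩ fun y hy => hy t ht)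
  rw [← hzt]
  exact supportFn_le ⟨f t, by rintro _ ⟨y, hy, rfl⟩; exact hy t ht⟩ hz

/-! ### Decomposition of sets and the minimality argument. -/

/-- The Riesz decomposition property of the semigroup `𝒞_V(E)` of a plane `E`. -/
theorem exists_riesz_decomposition_of_add_eq_add (hV : IsClosed (V : Set E))
    (hF : IsAdaptedFrame (V : Set E) e g p q) {C D : Set E}
    (hA : A ∈ closedConvexWithRecession (V : Set E))
    (hB : B ∈ closedConvexWithRecession (V : Set E))
    (hC : C ∈ closedConvexWithRecession (V : Set E))
    (hD : D ∈ closedConvexWithRecession (V : Set E)) (h : A + D = B + C) :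
    ∃ P ∈ closedConvexWithRecession (V : Set E), ∃ Q ∈ closedConvexWithRecession (V : Set E),
    ∃ R ∈ closedConvexWithRecession (V : Set E), ∃ S ∈ closedConvexWithRecession (V : Set E),
      A = P + Q ∧ D = R + S ∧ B = P + R ∧ C = Q + S := by
  set I := positiveParams (V : Set E) p q with hIdef
  have hconc : ∀ {X : Set E}, X ∈ closedConvexWithRecession (V : Set E) →
      ConcaveOn ℝ I (supportFn p q X) := fun hX =>
    concaveOn_supportFn (convex_positiveParams _ _ _) hX.1 fun t ht => bddBelow_image_of_pos hX ht
  have hadd : ∀ {X Y : Set E}, X ∈ closedConvexWithRecession (V : Set E) →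
      Y ∈ closedConvexWithRecession (V : Set E) → ∀ t ∈ I,
      supportFn p q (X + Y) t = supportFn p q X t + supportFn p q Y t := fun hX hY t ht =>
    supportFn_add hX.1 hY.1 (bddBelow_image_of_pos hX ht) (bddBelow_image_of_pos hY ht)
  have hsum : ∀ t ∈ I, supportFn p q A t + supportFn p q D t =
      supportFn p q B t + supportFn p q C t := fun t ht => by
    rw [← hadd hA hD t ht, ← hadd hB hC t ht, h]
  obtain ⟨m, hP, hQ, hR, hS⟩ := (hconc hA).exists_riesz_decomposition (hconc hB) (hconc hC)
    (hconc hD) hsum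
  have mem := fun {f : ℝ → ℝ} (hf : ConcaveOn ℝ I f) =>
    wulffShape_mem_closedConvexWithRecession hV hF hf
  have eq_add : ∀ {X : Set E} {f₁ f₂ : ℝ → ℝ}, X ∈ closedConvexWithRecession (V : Set E) →
      ConcaveOn ℝ I f₁ → ConcaveOn ℝ I f₂ → (∀ t ∈ I, supportFn p q X t = f₁ t + f₂ t) →
      X = wulffShape p q I f₁ + wulffShape p q I f₂ := by
    intro X f₁ f₂ hX h₁ h₂ hXf
    refine eq_of_supportFn_eq hF hX
      (add_mem_closedConvexWithRecession hV hF (mem h₁) (mem h₂)) fun t ht => ?_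
    rw [hadd (mem h₁) (mem h₂) t ht, supportFn_wulffShape hV hF h₁ ht,
      supportFn_wulffShape hV hF h₂ ht, hXf t ht]
  exact ⟨_, mem hP, _, mem hQ, _, mem hR, _, mem hS, eq_add hA hP hQ fun t _ => by ring,
    eq_add hD hR hS fun t _ => by ring, eq_add hB hP hR fun t _ => by ring,
    eq_add hC hQ hS fun t ht => by linarith [hsum t ht]⟩

theorem isReducedPair_of_isZeroMinimalPair (hV : IsClosed (V : Set E))
    (hF : IsAdaptedFrame (V : Set E) e g p q) (hA : A ∈ closedConvexWithRecession (V : Set E))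
    (hB : B ∈ closedConvexWithRecession (V : Set E)) (hAB : IsZeroMinimalPair (V : Set E) A B) :
    IsReducedPair (V : Set E) A B := by
  refine Set.Subset.antisymm ?_ ?_
  · rintro ⟨C, D⟩ ⟨hC, hD, h⟩
    obtain ⟨P, hP, Q, hQ, R, hR, S, hS, rfl, rfl, rfl, rfl⟩ :=
      exists_riesz_decomposition_of_add_eq_add hV hF hA hB hC hD h
    obtain ⟨x, hx, y, hy, hxy⟩ := hAB.prop.2
    simp only at hx hy hxy
    have hQP : x +ᵥ Q ⊆ P + Q := by
      rintro _ ⟨z, hz, rfl⟩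
      exact ⟨x, hx, z, hz, rfl⟩
    have hRP : x +ᵥ R ⊆ P + R := by
      rintro _ ⟨z, hz, rfl⟩
      exact ⟨x, hx, z, hz, rfl⟩
    -- The class condition is `(P + Q) + (x + R) = (P + R) + (x + Q)`, and `0 = x + y` lies in `x +
    -- R`.
    have hle := hAB.le_of_le (y := (x +ᵥ Q, x +ᵥ R))
      ⟨⟨vadd_mem_closedConvexWithRecession x hQ, vadd_mem_closedConvexWithRecession x hR, by
        simp only [← Set.singleton_vadd, vadd_eq_add]
        abel⟩, ⟨y, hy, hxy⟩⟩ ⟨hQP, hRP⟩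
    have hQ' : P + Q = x +ᵥ Q := hle.1.antisymm hQP
    have hR' : P + R = x +ᵥ R := hle.2.antisymm hRP
    refine ⟨-x +ᵥ S, vadd_mem_closedConvexWithRecession _ hS, ?_⟩
    rw [hQ', hR']
    have hcancel : ∀ X : Set E, X + S = (x +ᵥ X) + (-x +ᵥ S) := by
      intro X
      rw [vadd_add_assoc, add_comm X (-x +ᵥ S), vadd_add_assoc, vadd_vadd, add_neg_cancel,
        zero_vadd, add_comm]
    rw [← hcancel, ← hcancel]
  · rintro _ ⟨M, hM, rfl⟩
    exact ⟨add_mem_closedConvexWithRecession hV hF hA hM,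
      add_mem_closedConvexWithRecession hV hF hB hM, by
        simp only
        abel⟩

end Planar

/-! ### Coordinates in the plane. -/

theorem exists_isAdaptedFrame {V : PointedCone ℝ (EuclideanSpace ℝ (Fin 2))}
    (hV : IsClosed (V : Set (EuclideanSpace ℝ (Fin 2))))
    (hpt : (V : Set (EuclideanSpace ℝ (Fin 2))) ∩ -(V : Set (EuclideanSpace ℝ (Fin 2))) = {0})
    (hunb : ¬ Bornology.IsBounded (V : Set (EuclideanSpace ℝ (Fin 2)))) :
    ∃ e g p q, IsAdaptedFrame (V : Set (EuclideanSpace ℝ (Fin 2))) e g p q := by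
  obtain ⟨q, hq⟩ := exists_strongDual_pos hV hpt
  obtain ⟨v, hv, hv0⟩ : ∃ v ∈ V, v ≠ 0 := by
    by_contra! h
    exact hunb (Bornology.isBounded_singleton (x := (0 : EuclideanSpace ℝ (Fin 2))) |>.subset h)
  have hqv := hq v hv hv0
  let e := (q v)⁻¹ • v
  have he : e ∈ V := V.smul_mem (by positivity) hv
  have hqe : q e = 1 := by simp [e, hqv.ne']
  clear_value e
  have he0 : e ≠ 0 := fun h => by simp [h] at hqe
  have hsq : e 0 * e 0 + e 1 * e 1 ≠ 0 := by
    intro h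
    refine he0 (PiLp.ext fun i => ?_)
    fin_cases i <;> simp <;> nlinarith [mul_self_nonneg (e 0), mul_self_nonneg (e 1)]
  let p : StrongDual ℝ (EuclideanSpace ℝ (Fin 2)) :=
    e 1 • EuclideanSpace.proj 0 - e 0 • EuclideanSpace.proj 1
  have hp : ∀ z, p z = e 1 * z 0 - e 0 * z 1 := fun z => by simp [p]
  obtain ⟨r, hr⟩ : ∃ r, r * (e 0 * e 0 + e 1 * e 1) = 1 := ⟨_, inv_mul_cancel₀ hsq⟩
  let g' : EuclideanSpace ℝ (Fin 2) := !₂[r * e 1, -(r * e 0)]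
  have hg0 : g' 0 = r * e 1 := rfl
  have hg1 : g' 1 = -(r * e 0) := rfl
  have hpe : p e = 0 := by rw [hp]; ring
  have hpg' : p g' = 1 := by
    rw [hp, hg0, hg1]
    linear_combination hr
  have hrepr : ∀ z, ∃ c : ℝ, z = c • e + p z • g' := by
    intro z
    refine ⟨r * (e 0 * z 0 + e 1 * z 1), PiLp.ext fun i => ?_⟩
    rw [hp, PiLp.add_apply, PiLp.smul_apply, PiLp.smul_apply, smul_eq_mul, smul_eq_mul]
    fin_cases i
    · change z 0 = _ * e 0 + _ * g' 0
      rw [hg0]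
      linear_combination -(z 0) * hr
    · change z 1 = _ * e 1 + _ * g' 1
      rw [hg1]
      linear_combination -(z 1) * hr
  -- Subtracting `q g' • e` makes `q` vanish on the second basis vector and leaves `p` unchanged
  -- there, as `p e = 0`.
  refine ⟨e, g' - q g' • e, p, q, he, hq, hpe, hqe, ?_, ?_, fun z => ?_⟩
  · simp [hpg', hpe]
  · simp [hqe]
  · obtain ⟨c, hc⟩ := hrepr z
    have hqz : q z = c + p z * q g' := by
      conv_lhs => rw [hc]
      simp [hqe]
    rw [hqz]
    conv_lhs => rw [hc]
    module

theorem theorem4p6 (V : PointedCone ℝ (EuclideanSpace ℝ (Fin 2)))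
    (hV_closed : IsClosed (V : Set (EuclideanSpace ℝ (Fin 2))))
    (hV_pointed : (V : Set (EuclideanSpace ℝ (Fin 2))) ∩ -(V : Set (EuclideanSpace ℝ (Fin 2))) = {0})
    (hV_unbounded : ¬ Bornology.IsBounded (V : Set (EuclideanSpace ℝ (Fin 2))))
    (A B : Set (EuclideanSpace ℝ (Fin 2)))
    (hA : A ∈ closedConvexWithRecession (V : Set (EuclideanSpace ℝ (Fin 2))))
    (hB : B ∈ closedConvexWithRecession (V : Set (EuclideanSpace ℝ (Fin 2))))
    (hAB : IsZeroMinimalPair (V : Set (EuclideanSpace ℝ (Fin 2))) A B) :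
    IsReducedPair (V : Set (EuclideanSpace ℝ (Fin 2))) A B := by
  obtain ⟨e, g, p, q, hF⟩ := exists_isAdaptedFrame hV_closed hV_pointed hV_unbounded
  exact isReducedPair_of_isZeroMinimalPair hV_closed hF hA hB hAB
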